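/- Let $C$ be an algebraically closed field of characteristic zero. Let $R$ be an integral domain containing $C$ which is a differential ring with respect to a finite set $\Delta$ of commuting derivations, and let $K$ be the field of fractions of $R$ with the unique extensions of these derivations. Assume that $C$ is the field of constants of $K$ (the elements killed by all $\delta\in\Delta$) and that $K$ is differentially finitely generated over $C$, i.e. there is a finite set $s\subseteq K$ such that the only subfield of $K$ that contains $C\cup s$ and is stable under $\Delta$ is $K$ itself. Give $K\otimes_C R$ the derivations $\delta(x\otimes y)=\delta(x)\otimes y+x\otimes\delta(y)$ for $\delta\in\Delta$, and let $E\subseteq K\otimes_C R$ be its subring of constants. If the differential ring homomorphism $$\phi\colon K\otimes_C E\to K\otimes_C R,\qquad \phi(a\otimes d)=(a\otimes 1)\,d,$$ is an isomorphism, then $K/C$ is a strongly normal extension. Here $K/C$ is called strongly normal if $K$ is differentially finitely generated over $C$ and, for every differential field extension $M$ of $K$ with field of constants $D$, every homomorphism of differential fields $\sigma\colon K\to M$ over $C$ satisfies: $\sigma(c)=c$ for every constant $c$ of $K$, $\sigma K\subseteq K\cdot D$ and $K\subseteq \sigma K\cdot D$, where $K\cdot D$ and $\sigma K\cdot D$ denote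 the subfields of $M$ generated by $K\cup D$ and by $\sigma K\cup D$. -/

import Mathlib

open scoped TensorProduct

universe u v w x y

/-- A commutative `C`-algebra `A` with pairwise commuting derivations, indexed by `Δ`, for which
`C` consists of constants (i.e. the derivations are `C`-linear). -/
class DeltaAlgebra (Δ : Type y) (C : Type u) (A : Type v) [CommRing C] [CommRing A]
    [Algebra C A] where
  der : Δ → Derivation C A A
  der_comm : ∀ (i j : Δ) (a : A), der i (der j a) = der j (der i a)

namespace DeltaAlgebra

/-- A `C`-algebra homomorphism that commutes with the derivations. -/
def IsDeltaHom (Δ : Type y) {C : Type u} {A : Type v} {B : Type w} [CommRing C] [CommRing A]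
    [CommRing B] [Algebra C A] [Algebra C B] [DeltaAlgebra Δ C A] [DeltaAlgebra Δ C B]
    (f : A →ₐ[C] B) : Prop :=
  ∀ (i : Δ) (a : A), f (der (C := C) i a) = der (C := C) i (f a)

/-- The ring of constants: the elements killed by all the derivations. -/
def constants (Δ : Type y) (C : Type u) (A : Type v) [CommRing C] [CommRing A] [Algebra C A]
    [DeltaAlgebra Δ C A] : Subalgebra C A where
  carrier := {a | ∀ i : Δ, der (C := C) i a = 0}
  mul_mem' := by
    intro a b ha hb i
    simp [Derivation.leibniz, ha i, hb i]
  add_mem' := by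
    intro a b ha hb i
    simp [ha i, hb i]
  algebraMap_mem' := by
    intro c i
    simp

/-- The field of constants of a differential field. -/
def constantField (Δ : Type y) (C : Type u) (K : Type v) [Field C] [Field K] [Algebra C K]
    [DeltaAlgebra Δ C K] : IntermediateField C K where
  toSubalgebra := constants Δ C K
  inv_mem' := by
    intro a ha i
    have h := ha i
    simp [Derivation.leibniz_inv, h]

section Tensor

variable {C : Type u} {A : Type v} {B : Type w} [CommRing C] [CommRing A] [CommRing B]
  [Algebra C A] [Algebra C B]

/-- The derivation of `A ⊗ B` with `x ⊗ y ↦ d x ⊗ y + x ⊗ e y`. -/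
noncomputable def tensorDer (d : Derivation C A A) (e : Derivation C B B) :
    Derivation C (A ⊗[C] B) (A ⊗[C] B) :=
  Derivation.mk' ((d : A →ₗ[C] A).rTensor B + (e : B →ₗ[C] B).lTensor A) (by
    intro s t
    induction s using TensorProduct.induction_on with
    | zero => simp
    | add s₁ s₂ h₁ h₂ =>
      rw [add_mul, map_add, h₁, h₂, map_add]
      simp only [smul_eq_mul]
      ring
    | tmul a b =>
      induction t using TensorProduct.induction_on with
      | zero => simp
      | add t₁ t₂ h₁ h₂ =>
        rw [mul_add, map_add, h₁, h₂, map_add]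
        simp only [smul_eq_mul]
        ring
      | tmul a' b' =>
        simp only [Algebra.TensorProduct.tmul_mul_tmul, LinearMap.add_apply,
          LinearMap.rTensor_tmul, LinearMap.lTensor_tmul, Derivation.coeFn_coe,
          Derivation.leibniz, smul_eq_mul, mul_add, TensorProduct.add_tmul,
          TensorProduct.tmul_add, mul_comm a' _, mul_comm b' _]
        abel)

theorem tensorDer_tmul (d : Derivation C A A) (e : Derivation C B B) (a : A) (b : B) :
    tensorDer d e (a ⊗ₜ[C] b) = d a ⊗ₜ[C] b + a ⊗ₜ[C] e b := by
  simp [tensorDer]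

noncomputable instance instTensor (Δ : Type y) [DeltaAlgebra Δ C A] [DeltaAlgebra Δ C B] :
    DeltaAlgebra Δ C (A ⊗[C] B) where
  der i := tensorDer (der i) (der i)
  der_comm := by
    intro i j t
    induction t using TensorProduct.induction_on with
    | zero => simp
    | add s t hs ht => simp only [map_add, hs, ht]
    | tmul a b =>
      simp only [tensorDer_tmul, map_add, der_comm i j]
      abel

/-- The constants as a differential ring: every derivation is zero there. -/
instance instConstants (Δ : Type y) [DeltaAlgebra Δ C A] :
    DeltaAlgebra Δ C (constants Δ C A) where
  der _ := 0
  der_comm := by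
    intro i j a
    simp

/-- The canonical map `φ : A ⊗ E → A ⊗ B`, `φ (a ⊗ d) = (a ⊗ 1) d`, where `E` is the ring of
constants of the differential ring `A ⊗ B`. -/
noncomputable def phi (Δ : Type y) (C : Type u) (A : Type v) (B : Type w) [CommRing C]
    [CommRing A] [CommRing B] [Algebra C A] [Algebra C B] [DeltaAlgebra Δ C A]
    [DeltaAlgebra Δ C B] :
    A ⊗[C] (constants Δ C (A ⊗[C] B)) →ₐ[C] A ⊗[C] B :=
  Algebra.TensorProduct.productMap Algebra.TensorProduct.includeLeft
    (constants Δ C (A ⊗[C] B)).val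

theorem phi_tmul (Δ : Type y) [DeltaAlgebra Δ C A] [DeltaAlgebra Δ C B] (a : A)
    (d : constants Δ C (A ⊗[C] B)) :
    phi Δ C A B (a ⊗ₜ[C] d) = (a ⊗ₜ[C] (1 : B)) * (d : A ⊗[C] B) := by
  simp [phi]

theorem phi_isDeltaHom (Δ : Type y) [DeltaAlgebra Δ C A] [DeltaAlgebra Δ C B] :
    IsDeltaHom Δ (phi Δ C A B) := by
  intro i t
  induction t using TensorProduct.induction_on with
  | zero => simp
  | add s t hs ht => simp only [map_add, hs, ht]
  | tmul a d =>
    have h1 : der (C := C) i (a ⊗ₜ[C] d) = (der (C := C) i a) ⊗ₜ[C] d := by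
      change tensorDer _ _ _ = _
      rw [tensorDer_tmul]
      change _ + a ⊗ₜ[C] (0 : constants Δ C (A ⊗[C] B)) = _
      simp
    have h2 : der (C := C) i (a ⊗ₜ[C] (1 : B)) = (der (C := C) i a) ⊗ₜ[C] (1 : B) := by
      change tensorDer _ _ _ = _
      rw [tensorDer_tmul]
      simp
    rw [h1, phi_tmul, phi_tmul, Derivation.leibniz, d.2 i, h2]
    simp [mul_comm]

end Tensor

section Fields

/-- `K` is differentially finitely generated over `C`: for some finite `s ⊆ K`, the only
intermediate field that contains `s` and is closed under the derivations is `K` itself. -/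
def IsDiffFinitelyGenerated (Δ : Type y) (C : Type u) (K : Type v) [Field C] [Field K]
    [Algebra C K] [DeltaAlgebra Δ C K] : Prop :=
  ∃ s : Finset K, ∀ L : IntermediateField C K, (s : Set K) ⊆ L →
    (∀ (i : Δ), ∀ a ∈ L, der (C := C) i a ∈ L) → L = ⊤

/-- For a differential field extension `M` of `K`, a differential embedding `σ : K → M` over `C`
is strong if it fixes the constants of `K` and `σK ⊆ K·D` and `K ⊆ σK·D`, where `D` is the field
of constants of `M`. -/
structure IsStrong (Δ : Type y) (C : Type u) {K : Type v} {M : Type w} [Field C] [Field K]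
    [Field M] [Algebra C K] [Algebra C M] [Algebra K M] [IsScalarTower C K M]
    [DeltaAlgebra Δ C K] [DeltaAlgebra Δ C M] (σ : K →ₐ[C] M) : Prop where
  map_constant : ∀ c ∈ constants Δ C K, σ c = algebraMap K M c
  range_le : σ.fieldRange ≤ (IsScalarTower.toAlgHom C K M).fieldRange ⊔ constantField Δ C M
  le_range : (IsScalarTower.toAlgHom C K M).fieldRange ≤ σ.fieldRange ⊔ constantField Δ C M

/-- The differential field extension `K` of the field of constants `C` is strongly normal: it is
differentially finitely generated, and for every differential field extension `M` of `K`, every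
differential embedding `σ : K → M` over `C` is strong. -/
structure IsStronglyNormal (Δ : Type y) (C : Type u) (K : Type v) [Field C] [Field K]
    [Algebra C K] [DeltaAlgebra Δ C K] : Prop where
  finitelyGenerated : IsDiffFinitelyGenerated Δ C K
  strong : ∀ (M : Type (max v w)) [Field M] [Algebra C M] [Algebra K M] [IsScalarTower C K M]
    [DeltaAlgebra Δ C M], IsDeltaHom Δ (IsScalarTower.toAlgHom C K M) →
    ∀ σ : K →ₐ[C] M, IsDeltaHom Δ σ → IsStrong Δ C σ

end Fields

end DeltaAlgebra

/-! Two differential embeddings `f g : K → M` combine into a differential homomorphism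
`τ : K ⊗ R → M`, `a ⊗ r ↦ f a * g r`, which sends the constants `E` of `K ⊗ R` to constants of `M`.
Surjectivity of `φ` says that `1 ⊗ r` is a sum of products `(a ⊗ 1) d` with `d ∈ E`, and applying
`τ` gives `g r ∈ f K · D`, where `D` is the field of constants of `M`. As `K` is the field of
fractions of `R`, it follows that `g K ⊆ f K · D` (`DeltaAlgebra.fieldRange_le_of_surjective_phi`).
Strong normality needs this for the pairs (inclusion, `σ`) and (`σ`, inclusion): the argument is
symmetric in the two embeddings. -/

namespace DeltaAlgebra

theorem IsDeltaHom.comp {Δ : Type y} {C : Type u} {A : Type v} {B : Type w} {B' : Type x}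
    [CommRing C] [CommRing A] [CommRing B] [CommRing B'] [Algebra C A] [Algebra C B] [Algebra C B']
    [DeltaAlgebra Δ C A] [DeltaAlgebra Δ C B] [DeltaAlgebra Δ C B'] {g : B →ₐ[C] B'}
    {f : A →ₐ[C] B} (hg : IsDeltaHom Δ g) (hf : IsDeltaHom Δ f) : IsDeltaHom Δ (g.comp f) :=
  fun i a => by rw [AlgHom.comp_apply, hf, hg, AlgHom.comp_apply]

theorem IsDeltaHom.map_mem_constants {Δ : Type y} {C : Type u} {A : Type v} {B : Type w}
    [CommRing C] [CommRing A] [CommRing B] [Algebra C A] [Algebra C B] [DeltaAlgebra Δ C A]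
    [DeltaAlgebra Δ C B] {f : A →ₐ[C] B} (hf : IsDeltaHom Δ f) {a : A}
    (ha : a ∈ constants Δ C A) : f a ∈ constants Δ C B :=
  fun i => by rw [← hf, ha i, map_zero]

theorem IsDeltaHom.productMap {Δ : Type y} {C : Type u} {A : Type v} {B : Type w} {M : Type x}
    [CommRing C] [CommRing A] [CommRing B] [CommRing M] [Algebra C A] [Algebra C B] [Algebra C M]
    [DeltaAlgebra Δ C A] [DeltaAlgebra Δ C B] [DeltaAlgebra Δ C M] {f : A →ₐ[C] M}
    {g : B →ₐ[C] M} (hf : IsDeltaHom Δ f) (hg : IsDeltaHom Δ g) :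
    IsDeltaHom Δ (Algebra.TensorProduct.productMap f g) := by
  intro i t
  induction t using TensorProduct.induction_on with
  | zero => simp
  | add s t hs ht => simp only [map_add, hs, ht]
  | tmul a b =>
    change Algebra.TensorProduct.productMap f g (tensorDer _ _ _) = _
    rw [tensorDer_tmul]
    simp only [map_add, Algebra.TensorProduct.productMap_apply_tmul, Derivation.leibniz,
      smul_eq_mul, hf i a, hg i b]
    ring

/-- If `φ` is surjective, any two differential embeddings `f`, `g` of `K` into `M` satisfy
`g K ⊆ f K · D`, where `D` is the field of constants of `M`. -/
theorem fieldRange_le_of_surjective_phi {Δ : Type y} {C : Type u} {R : Type x} {K : Type v}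
    {M : Type w} [Field C] [CommRing R] [Algebra C R] [DeltaAlgebra Δ C R] [Field K] [Algebra C K]
    [Algebra R K] [IsScalarTower C R K] [IsFractionRing R K] [DeltaAlgebra Δ C K] [Field M]
    [Algebra C M] [DeltaAlgebra Δ C M] (hRK : IsDeltaHom Δ (IsScalarTower.toAlgHom C R K))
    (hphi : Function.Surjective (phi Δ C K R)) {f g : K →ₐ[C] M} (hf : IsDeltaHom Δ f)
    (hg : IsDeltaHom Δ g) : g.fieldRange ≤ f.fieldRange ⊔ constantField Δ C M := by
  set L := f.fieldRange ⊔ constantField Δ C M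
  have hfL : f.fieldRange ≤ L := le_sup_left
  have hDL : constantField Δ C M ≤ L := le_sup_right
  let τ : K ⊗[C] R →ₐ[C] M :=
    Algebra.TensorProduct.productMap f (g.comp (IsScalarTower.toAlgHom C R K))
  have hτ : IsDeltaHom Δ τ := hf.productMap (hg.comp hRK)
  have hphiL (t : K ⊗[C] constants Δ C (K ⊗[C] R)) : τ (phi Δ C K R t) ∈ L := by
    induction t using TensorProduct.induction_on with
    | zero => simp
    | add s t hs ht => simpa only [map_add] using add_mem hs ht
    | tmul a d =>
      rw [phi_tmul, map_mul]
      refine mul_mem (hfL ⟨a, ?_⟩) (hDL (hτ.map_mem_constants d.2))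
      simp [τ]
  have hR (r : R) : g (algebraMap R K r) ∈ L := by
    obtain ⟨t, ht⟩ := hphi (1 ⊗ₜ[C] r)
    simpa [ht, τ] using hphiL t
  rintro _ ⟨k, rfl⟩
  obtain ⟨a, b, -, rfl⟩ := IsFractionRing.div_surjective (A := R) k
  change g _ ∈ L
  rw [map_div₀]
  exact div_mem (hR a) (hR b)

end DeltaAlgebra

theorem theorem2p5 (Δ : Type y) [Finite Δ] (C : Type u) [Field C] [IsAlgClosed C] [CharZero C]
    (R : Type x) [CommRing R] [IsDomain R] [Algebra C R] [DeltaAlgebra Δ C R]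
    (K : Type v) [Field K] [Algebra C K] [Algebra R K] [IsScalarTower C R K]
    [IsFractionRing R K] [DeltaAlgebra Δ C K]
    (hRK : DeltaAlgebra.IsDeltaHom Δ (IsScalarTower.toAlgHom C R K))
    (hC : DeltaAlgebra.constants Δ C K = ⊥)
    (hfg : DeltaAlgebra.IsDiffFinitelyGenerated Δ C K)
    (hphi : Function.Bijective (DeltaAlgebra.phi Δ C K R)) :
    DeltaAlgebra.IsStronglyNormal.{u, v, w, y} Δ C K := by
  refine ⟨hfg, ?_⟩
  intro M _ _ _ _ _ hKM σ hσ
  refine ⟨fun c hc => ?_,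
    DeltaAlgebra.fieldRange_le_of_surjective_phi hRK hphi.surjective hKM hσ,
    DeltaAlgebra.fieldRange_le_of_surjective_phi hRK hphi.surjective hσ hKM⟩
  rw [hC] at hc
  obtain ⟨c, rfl⟩ := Algebra.mem_bot.mp hc
  rw [AlgHom.commutes, ← IsScalarTower.algebraMap_apply]
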